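/- Let $K$ be a field. Call a finite-dimensional $K$-algebra $B$ \emph{symmetric} if $B\cong \operatorname{Hom}_K(B,K)$ as $B$-bimodules, and call a finite-dimensional right $B$-module $M$ a \emph{generator} if the regular right module $B$ is a direct summand of $M^n$ for some $n$. A $K$-algebra $A$ is called \emph{gendo-symmetric} if it is isomorphic, as a $K$-algebra, to $\operatorname{End}_B(M)$ for some finite-dimensional symmetric $K$-algebra $B$ and some finite-dimensional right $B$-module $M$ that is a generator; such an $A$ is finite-dimensional. 1. If $A$ and $B$ are gendo-symmetric $K$-algebras, then $A\otimes_K B$ is a gendo-symmetric $K$-algebra. 2. Let $A$ be a gendo-symmetric $K$-algebra and let $F$ be any field extension of $K$. Then $A\otimes_K F$ is a gendo-symmetric $F$-algebra. If moreover $F$ is finite-dimensional over $K$, then $A\otimes_K F$ is also gendo-symmetric as a $K$-algebra. -/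

import Mathlib

universe u v w x

open scoped TensorProduct

/-- A symmetric algebra over the field `K`: a finite dimensional algebra `B` which is isomorphic,
as a `B`-bimodule, to its dual `D(B) = Hom_K(B, K)`. The bimodule structure of `D(B)` is
`(a • f • b) y = f (b * y * a)`, so that the displayed equation says `φ (a x b) = a • φ x • b`. -/
def IsSymmetricAlg (K : Type*) [Field K] (B : Type*) [Ring B] [Algebra K B] : Prop :=
  Module.Finite K B ∧
    ∃ φ : B ≃ₗ[K] Module.Dual K B, ∀ a x b y : B, φ (a * x * b) y = φ x (b * y * a)

/-- The right `B`-module `M` is a generator: the regular right module `B` is a direct summand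
of a finite direct sum of copies of `M`. Right `B`-modules are modules over `Bᵐᵒᵖ`. -/
def IsGeneratorRightModule (B : Type*) [Ring B] (M : Type*) [AddCommGroup M] [Module Bᵐᵒᵖ M] :
    Prop :=
  ∃ (n : ℕ) (i : B →ₗ[Bᵐᵒᵖ] (Fin n → M)) (p : (Fin n → M) →ₗ[Bᵐᵒᵖ] B), p ∘ₗ i = LinearMap.id

/-- A `K`-algebra `A` is gendo-symmetric if it is isomorphic, as a `K`-algebra, to the algebra
`End_B(M)` of endomorphisms of a finite dimensional right module `M` that is a generator over a
symmetric `K`-algebra `B`. Such an `A` is finite dimensional.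

Taking `B` and `M` in the universe of `A` is no restriction: if `A` is nonzero then `K` embeds
in `A`, so every finite dimensional `K`-vector space has a copy in that universe; if `A` is zero
then so are `M` and `B`. -/
def IsGendoSymmetric (K : Type*) [Field K] (A : Type u) [Ring A] [Algebra K A] : Prop :=
  ∃ (B : Type u) (_ : Ring B) (_ : Algebra K B) (M : Type u) (_ : AddCommGroup M)
    (_ : Module K M) (_ : Module Bᵐᵒᵖ M) (_ : IsScalarTower K Bᵐᵒᵖ M),
    IsSymmetricAlg K B ∧ Module.Finite K M ∧ IsGeneratorRightModule B M ∧
      Nonempty (A ≃ₐ[K] Module.End Bᵐᵒᵖ M)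

open MulOpposite

/-! If `A = End_B(M)` and `C = End_D(N)`, then `A ⊗ C = End_{B ⊗ D}(M ⊗ N)`: finite dimensionality
gives `End(M) ⊗ End(N) = End(M ⊗ N)`, and over a field the commutant of a tensor product is the
tensor product of the commutants. Symmetry of `B ⊗ D` comes from tensoring the bimodule
isomorphisms, and the generator property from tensoring the splittings. All claims follow from one
statement over a tower `F / K`, with `A` over `F` and `C` over `K`. Taking `F = K` gives products;
putting the field `F`, gendo-symmetric over itself, in place of `A` gives base change. For `F / K`
finite, `F` is gendo-symmetric over `K`, so the last claim is again a product. -/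

/-- A presentation of a gendo-symmetric algebra `A` by algebra homomorphisms into `End_K(M)`: the
right action of `B` on `M`, and a faithful action of `A` whose image is the commutant of `B`. -/
theorem isGendoSymmetric_iff (K : Type*) [Field K] (A : Type u) [Ring A] [Algebra K A] :
    IsGendoSymmetric K A ↔
      ∃ (B : Type u) (_ : Ring B) (_ : Algebra K B) (M : Type u) (_ : AddCommGroup M)
        (_ : Module K M) (ρ : Bᵐᵒᵖ →ₐ[K] Module.End K M) (Φ : A →ₐ[K] Module.End K M),
        IsSymmetricAlg K B ∧ Module.Finite K M ∧
        (∃ (n : ℕ) (m : Fin n → M) (p : Fin n → M →ₗ[K] B),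
          (∀ j b x, p j (ρ (op b) x) = p j x * b) ∧ ∑ j, p j (m j) = 1) ∧
        Function.Injective Φ ∧ ∀ f, (∃ a, Φ a = f) ↔ ∀ b, Commute (ρ b) f := by
  constructor
  · rintro ⟨B, _, _, M, _, _, _, _, hB, hM, ⟨n, i, p, hip⟩, ⟨e⟩⟩
    have : SMulCommClass Bᵐᵒᵖ K M := IsScalarTower.to_smulCommClass'
    let forget : Module.End Bᵐᵒᵖ M →ₐ[K] Module.End K M :=
      AlgHom.ofLinearMap
        { toFun := fun f => f.restrictScalars K
          map_add' := fun _ _ => rfl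
          map_smul' := fun _ _ => rfl } rfl fun _ _ => rfl
    -- A linear map out of the regular module is determined by its value at 1, so the splitting `p ∘
    -- i = id` reduces to the tuple `i 1` and one equation at 1.
    refine ⟨B, _, _, M, _, _, Algebra.lsmul K K M, forget.comp e.toAlgHom, hB, hM,
      ⟨n, i 1, fun j => (p ∘ₗ LinearMap.single Bᵐᵒᵖ (fun _ => M) j).restrictScalars K, ?_, ?_⟩,
      ?_, fun f => ⟨?_, fun hf => ?_⟩⟩
    · intro j b x
      exact (p ∘ₗ LinearMap.single Bᵐᵒᵖ (fun _ => M) j).map_smul (op b) x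
    · calc _ = p (∑ j, Pi.single j (i 1 j)) := (map_sum p _ _).symm
        _ = p (i 1) := by rw [Finset.univ_sum_single]
        _ = 1 := LinearMap.congr_fun hip 1
    · have hforget : Function.Injective forget :=
        fun f g h => LinearMap.ext fun x => LinearMap.congr_fun h x
      exact hforget.comp e.injective
    · rintro ⟨a, rfl⟩ b
      exact LinearMap.ext fun x => ((e a).map_smul b x).symm
    · let g : Module.End Bᵐᵒᵖ M :=
        { f with map_smul' := fun b x => (LinearMap.congr_fun (hf b) x).symm }
      refine ⟨e.symm g, LinearMap.ext fun x => ?_⟩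
      change e (e.symm g) x = f x
      rw [e.apply_symm_apply]
      rfl
  · rintro ⟨B, _, _, M, _, _, ρ, Φ, hB, hM, ⟨n, m, p, hp, hpm⟩, hΦ, hr⟩
    let : Module Bᵐᵒᵖ M := Module.compHom M ρ.toRingHom
    have smul_def : ∀ (b : Bᵐᵒᵖ) (x : M), b • x = ρ b x := fun _ _ => rfl
    have : IsScalarTower K Bᵐᵒᵖ M := ⟨fun k b x => by simp [smul_def]⟩
    have : SMulCommClass Bᵐᵒᵖ K M := IsScalarTower.to_smulCommClass'
    refine ⟨B, _, _, M, _, _, inferInstance, inferInstance, hB, hM, ⟨n,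
      LinearMap.pi fun j => LinearMap.toSpanSingleton Bᵐᵒᵖ M (m j) ∘ₗ
        (opLinearEquiv Bᵐᵒᵖ : B ≃ₗ[Bᵐᵒᵖ] Bᵐᵒᵖ).toLinearMap,
      ∑ j, ({ p j with map_smul' := fun b x => hp j b.unop x } : M →ₗ[Bᵐᵒᵖ] B) ∘ₗ
        LinearMap.proj j, ?_⟩, ⟨AlgEquiv.ofBijective
          (AlgHom.ofLinearMap
            { toFun := fun a =>
                ({ Φ a with
                    map_smul' := fun b x =>
                      (LinearMap.congr_fun ((hr (Φ a)).1 ⟨a, rfl⟩ b) x).symm } :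
                  Module.End Bᵐᵒᵖ M)
              map_add' := fun a b => LinearMap.ext fun x => by simp
              map_smul' := fun k a => LinearMap.ext fun x => by simp }
            (LinearMap.ext fun x => by simp) fun a b => LinearMap.ext fun x => by simp)
          ⟨fun a b h => hΦ (LinearMap.ext fun x => LinearMap.congr_fun h x), fun f => ?_⟩⟩⟩
    · refine LinearMap.ext fun b => ?_
      have : ∀ j, p j (ρ (op b) (m j)) = p j (m j) * b := fun j => hp j b (m j)
      suffices ∑ j, p j (ρ (op b) (m j)) = b by
        rw [LinearMap.comp_apply, LinearMap.sum_apply]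
        exact this
      simp only [this, ← Finset.sum_mul, hpm, one_mul]
    · obtain ⟨a, ha⟩ := (hr (f.restrictScalars K)).2 fun b =>
        LinearMap.ext fun x => (f.map_smul b x).symm
      exact ⟨a, LinearMap.ext fun x => LinearMap.congr_fun ha x⟩

/-- Tensoring linear maps between finite free modules is bijective, over a tower of scalars. -/
theorem homTensorHomMap_bijective (K F M N P Q : Type*) [CommRing K] [CommRing F]
    [Algebra K F] [AddCommGroup M] [Module K M] [Module F M] [IsScalarTower K F M]
    [AddCommGroup N] [Module K N] [AddCommGroup P] [Module K P] [Module F P]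
    [IsScalarTower K F P] [AddCommGroup Q] [Module K Q]
    [Module.Finite F M] [Module.Free F M] [Module.Finite F P] [Module.Free F P]
    [Module.Finite K N] [Module.Free K N] [Module.Finite K Q] [Module.Free K Q] :
    Function.Bijective (TensorProduct.AlgebraTensorModule.homTensorHomMap K F F M N P Q) := by
  classical
  let bM := Module.Free.chooseBasis F M
  let bN := Module.Free.chooseBasis K N
  let bP := Module.Free.chooseBasis F P
  let bQ := Module.Free.chooseBasis K Q
  -- The tensor product of two matrix units is a matrix unit; only the indices are regrouped, from
  -- `((i, j), (k, l))` to `((i, k), (j, l))`.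
  let e := ((bM.linearMap bP).tensorProduct (bN.linearMap bQ)).equiv
    ((bM.tensorProduct bN).linearMap (bP.tensorProduct bQ)) (Equiv.prodProdProdComm _ _ _ _)
  have : TensorProduct.AlgebraTensorModule.homTensorHomMap K F F M N P Q = e.toLinearMap := by
    refine ((bM.linearMap bP).tensorProduct (bN.linearMap bQ)).ext ?_
    rintro ⟨⟨i, j⟩, ⟨k, l⟩⟩
    refine (bM.tensorProduct bN).ext ?_
    rintro ⟨j', l'⟩
    rw [LinearEquiv.coe_coe, Module.Basis.equiv_apply, Module.Basis.linearMap_apply_apply]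
    simp only [Equiv.prodProdProdComm_apply,
      Module.Basis.linearMap_apply_apply, Module.Basis.tensorProduct_apply,
      TensorProduct.AlgebraTensorModule.homTensorHomMap_apply,
      TensorProduct.AlgebraTensorModule.map_tmul, Prod.mk.injEq]
    split_ifs <;> simp_all
  rw [this]
  exact e.bijective

theorem finite_tensorProduct_of_tower (K F M N : Type*) [CommRing K] [CommRing F]
    [Algebra K F] [AddCommGroup M] [Module K M] [Module F M] [IsScalarTower K F M]
    [AddCommGroup N] [Module K N] [Module.Finite F M] [Module.Free F M]
    [Module.Finite K N] [Module.Free K N] : Module.Finite F (M ⊗[K] N) :=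
  .of_basis ((Module.Free.chooseBasis F M).tensorProduct (Module.Free.chooseBasis K N))

/-- The tensor product of symmetric algebras, over a tower of fields. -/
theorem IsSymmetricAlg.tensorProduct {K F B D : Type*} [Field K] [Field F] [Algebra K F]
    [Ring B] [Algebra K B] [Algebra F B] [IsScalarTower K F B] [Ring D] [Algebra K D]
    (hB : IsSymmetricAlg F B) (hD : IsSymmetricAlg K D) : IsSymmetricAlg F (B ⊗[K] D) := by
  obtain ⟨_, φ, hφ⟩ := hB
  obtain ⟨_, ψ, hψ⟩ := hD
  let e := (TensorProduct.AlgebraTensorModule.congr φ ψ ≪≫ₗ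
    LinearEquiv.ofBijective _ (homTensorHomMap_bijective K F B D F K)) ≪≫ₗ
    (Algebra.TensorProduct.rid K F F).toLinearEquiv.congrRight
  have he : ∀ b d b' d', e (b ⊗ₜ d) (b' ⊗ₜ d') = ψ d d' • φ b b' := fun _ _ _ _ => rfl
  refine ⟨finite_tensorProduct_of_tower K F B D, e, fun a x b y => ?_⟩
  induction a with
  | zero => simp
  | add a₁ a₂ h₁ h₂ => simp only [add_mul, mul_add, map_add, LinearMap.add_apply, h₁, h₂]
  | tmul a₁ a₂ =>
  induction b with
  | zero => simp
  | add b₁ b₂ h₁ h₂ => simp only [add_mul, mul_add, map_add, LinearMap.add_apply, h₁, h₂]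
  | tmul b₁ b₂ =>
  induction x with
  | zero => simp
  | add x₁ x₂ h₁ h₂ => simp only [add_mul, mul_add, map_add, LinearMap.add_apply, h₁, h₂]
  | tmul x₁ x₂ =>
  induction y with
  | zero => simp
  | add y₁ y₂ h₁ h₂ => simp only [add_mul, mul_add, map_add, h₁, h₂]
  | tmul y₁ y₂ => simp only [Algebra.TensorProduct.tmul_mul_tmul, he, hφ, hψ]

/-- Over a field, the commutant of `S ⊗ 1` and `1 ⊗ T` is the tensor product of commutants. -/
theorem Subalgebra.exists_map_centralizer_eq {K P Q : Type*} [Field K] [Ring P] [Algebra K P]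
    [Ring Q] [Algebra K Q] (S : Set P) (T : Set Q) (x : P ⊗[K] Q)
    (hS : ∀ s ∈ S, Commute (s ⊗ₜ[K] (1 : Q)) x) (hT : ∀ t ∈ T, Commute ((1 : P) ⊗ₜ[K] t) x) :
    ∃ v, Algebra.TensorProduct.map (Subalgebra.centralizer K S).val
      (Subalgebra.centralizer K T).val v = x := by
  have hx : x ∈ Subalgebra.centralizer K
      (Algebra.TensorProduct.includeLeft (R := K) (S := K) (A := P) (B := Q) '' S) := by
    rintro _ ⟨s, hs, rfl⟩
    exact hS s hs
  rw [Subalgebra.centralizer_coe_image_includeLeft_eq_center_tensorProduct] at hx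
  obtain ⟨w, rfl⟩ := hx
  -- Commuting with `S ⊗ 1` has put `x` in `C(S) ⊗ Q`. By flatness this embeds in `P ⊗ Q`, so
  -- commutation with `1 ⊗ T` can be tested inside it.
  have hinj : Function.Injective (Algebra.TensorProduct.map (Subalgebra.centralizer K S).val
      (AlgHom.id K Q)) :=
    Module.Flat.rTensor_preserves_injective_linearMap (M := Q)
      (Subalgebra.centralizer K S).val.toLinearMap Subtype.val_injective
  have hw : w ∈ Subalgebra.centralizer K (Algebra.TensorProduct.includeRight
      (R := K) (A := Subalgebra.centralizer K S) (B := Q) '' T) := by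
    rintro _ ⟨t, ht, rfl⟩
    apply hinj
    simpa [Commute, SemiconjBy] using hT t ht
  rw [Subalgebra.centralizer_coe_image_includeRight_eq_center_tensorProduct] at hw
  obtain ⟨v, rfl⟩ := hw
  refine ⟨v, ?_⟩
  change _ = ((Algebra.TensorProduct.map _ _).comp (Algebra.TensorProduct.map _ _)) v
  rw [← Algebra.TensorProduct.map_comp]
  rfl

/-- The tensor product of gendo-symmetric algebras, over a tower of fields. -/
theorem IsGendoSymmetric.tensorProduct {K F : Type*} [Field K] [Field F] [Algebra K F]
    {A : Type v} [Ring A] [Algebra K A] [Algebra F A] [IsScalarTower K F A]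
    {C : Type w} [Ring C] [Algebra K C]
    (hA : IsGendoSymmetric F A) (hC : IsGendoSymmetric K C) :
    IsGendoSymmetric F (A ⊗[K] C) := by
  rw [isGendoSymmetric_iff] at hA hC ⊢
  obtain ⟨B, _, _, M, _, _, ρ, Φ, hB, _, ⟨n, m, p, hp, hpm⟩, hΦ, hΦr⟩ := hA
  obtain ⟨D, _, _, N, _, _, σ, Ψ, hD, _, ⟨n', m', q, hq, hqm⟩, hΨ, hΨr⟩ := hC
  let : Algebra K B := Algebra.compHom B (algebraMap K F)
  have : IsScalarTower K F B := .of_algebraMap_eq fun _ => rfl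
  let : Module K M := Module.compHom M (algebraMap K F)
  have : IsScalarTower K F M := ⟨fun k f x => by rw [Algebra.smul_def, mul_smul]; rfl⟩
  let E : Module.End F M ⊗[K] Module.End K N →ₐ[F] Module.End F (M ⊗[K] N) :=
    Module.endTensorEndAlgHom
  have hE : Function.Bijective E := homTensorHomMap_bijective K F M N M N
  have hEt : ∀ f g x y, E (f ⊗ₜ g) (x ⊗ₜ y) = f x ⊗ₜ g y := fun _ _ _ _ => rfl
  have hΦΨ : Function.Injective (Algebra.TensorProduct.map Φ Ψ) := by
    have h₁ := Module.Flat.rTensor_preserves_injective_linearMap (M := C)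
      (Φ.toLinearMap.restrictScalars K) hΦ
    have h₂ := Module.Flat.lTensor_preserves_injective_linearMap (M := Module.End F M)
      Ψ.toLinearMap hΨ
    have h := h₂.comp h₁
    rw [← LinearMap.coe_comp, LinearMap.lTensor_comp_rTensor] at h
    exact h
  have hr : ∀ b d, (Algebra.TensorProduct.map ρ σ) ((Algebra.TensorProduct.opAlgEquiv K F B D).symm
      (op (b ⊗ₜ d))) = ρ (op b) ⊗ₜ σ (op d) := fun _ _ => rfl
  refine ⟨B ⊗[K] D, inferInstance, inferInstance, M ⊗[K] N, inferInstance, inferInstance,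
    E.comp ((Algebra.TensorProduct.map ρ σ).comp
      (Algebra.TensorProduct.opAlgEquiv K F B D).symm.toAlgHom),
    E.comp (Algebra.TensorProduct.map Φ Ψ), hB.tensorProduct hD,
    finite_tensorProduct_of_tower K F M N,
    ⟨n * n', fun j => m (finProdFinEquiv.symm j).1 ⊗ₜ m' (finProdFinEquiv.symm j).2,
      fun j => TensorProduct.AlgebraTensorModule.map (p (finProdFinEquiv.symm j).1)
        (q (finProdFinEquiv.symm j).2), fun j b x => ?_, ?_⟩,
    hE.injective.comp hΦΨ, fun f => ⟨?_, fun hf => ?_⟩⟩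
  · simp only [AlgHom.comp_apply, AlgEquiv.coe_toAlgHom]
    induction b with
    | zero => simp
    | add b₁ b₂ h₁ h₂ => simp only [op_add, map_add, LinearMap.add_apply, mul_add, h₁, h₂]
    | tmul b d =>
    rw [hr]
    induction x with
    | zero => simp
    | add x₁ x₂ h₁ h₂ => simp only [map_add, add_mul, h₁, h₂]
    | tmul x y => simp [hEt, hp, hq]
  · rw [← finProdFinEquiv.sum_comp]
    simp only [Equiv.symm_apply_apply, TensorProduct.AlgebraTensorModule.map_tmul,
      Fintype.sum_prod_type, ← TensorProduct.tmul_sum, ← TensorProduct.sum_tmul, hpm, hqm]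
    rfl
  · rintro ⟨a, rfl⟩ b
    refine Commute.map ?_ E
    obtain ⟨b, rfl⟩ := op_surjective b
    simp only [AlgHom.comp_apply, RingHom.coe_coe, AlgEquiv.coe_toAlgHom]
    induction b with
    | zero => simp
    | add b₁ b₂ h₁ h₂ => simpa only [op_add, map_add] using h₁.add_left h₂
    | tmul b d =>
    rw [hr]
    induction a with
    | zero => simp
    | add x₁ x₂ h₁ h₂ => simpa only [map_add] using h₁.add_right h₂
    | tmul x y =>
      have h₁ := ((hΦr (Φ x)).1 ⟨x, rfl⟩ (op b)).eq
      have h₂ := ((hΨr (Ψ y)).1 ⟨y, rfl⟩ (op d)).eq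
      simp [Commute, SemiconjBy, h₁, h₂]
  · obtain ⟨x, rfl⟩ := hE.surjective f
    -- Setting `d = 1` or `b = 1` below separates this into commutation with each tensor factor.
    have hx : ∀ b d, Commute (ρ (op b) ⊗ₜ[K] σ (op d)) x := fun b d =>
      by
      have h : E _ * E x = E x * E _ := (hf (op (b ⊗ₜ d))).eq
      rw [← map_mul, ← map_mul] at h
      exact hE.injective h
    obtain ⟨v, rfl⟩ := Subalgebra.exists_map_centralizer_eq (Set.range ρ) (Set.range σ) x
      (by rintro _ ⟨b, rfl⟩; simpa using hx b.unop 1)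
      (by rintro _ ⟨d, rfl⟩; simpa using hx 1 d.unop)
    clear hf hx
    suffices h : ∃ a, Algebra.TensorProduct.map Φ Ψ a = Algebra.TensorProduct.map
        (Subalgebra.centralizer K (Set.range ρ)).val
        (Subalgebra.centralizer K (Set.range σ)).val v by
      obtain ⟨a, ha⟩ := h
      exact ⟨a, congrArg E ha⟩
    induction v with
    | zero => exact ⟨0, by simp⟩
    | add v₁ v₂ h₁ h₂ =>
      obtain ⟨a₁, h₁⟩ := h₁
      obtain ⟨a₂, h₂⟩ := h₂
      exact ⟨a₁ + a₂, by rw [map_add, map_add, h₁, h₂]⟩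
    | tmul f g =>
      obtain ⟨a, ha⟩ := (hΦr f).2 fun b => f.2 _ ⟨b, rfl⟩
      obtain ⟨c, hc⟩ := (hΨr g).2 fun d => g.2 _ ⟨d, rfl⟩
      exact ⟨a ⊗ₜ c, by simp [ha, hc]⟩

theorem IsGendoSymmetric.of_algEquiv {K : Type*} [Field K] {A A' : Type u} [Ring A] [Algebra K A]
    [Ring A'] [Algebra K A'] (e : A' ≃ₐ[K] A) (h : IsGendoSymmetric K A) :
    IsGendoSymmetric K A' := by
  obtain ⟨B, _, _, M, _, _, _, _, hB, hM, hg, ⟨f⟩⟩ := h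
  exact ⟨B, _, _, M, _, _, _, _, hB, hM, hg, ⟨e.trans f⟩⟩

/-- A finite field extension is a symmetric algebra: its dual is one dimensional over it. -/
theorem isSymmetricAlg_of_field (K F : Type*) [Field K] [Field F] [Algebra K F]
    [Module.Finite K F] : IsSymmetricAlg K F := by
  obtain ⟨t, ht⟩ : ∃ t : Module.Dual K F, t 1 ≠ 0 := by
    by_contra! h
    exact one_ne_zero ((Module.forall_dual_apply_eq_zero_iff K (1 : F)).1 h)
  -- The form `(x, y) ↦ t (x * y)` is nondegenerate: a nonzero `x` pairs with `x⁻¹` to `t 1 ≠ 0`.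
  let φ : F →ₗ[K] Module.Dual K F := (LinearMap.mul K F).compr₂ t
  have hφ : Function.Injective φ := by
    rw [injective_iff_map_eq_zero]
    intro x hx
    by_contra h
    have : t (x * x⁻¹) = 0 := LinearMap.congr_fun hx x⁻¹
    rw [mul_inv_cancel₀ h] at this
    exact ht this
  refine ⟨inferInstance, LinearEquiv.ofInjectiveOfFinrankEq φ hφ
    Subspace.dual_finrank_eq.symm, fun a x b y => ?_⟩
  change t (a * x * b * y) = t (x * (b * y * a))
  congr 1
  ring

/-- A finite field extension is the endomorphism algebra of its regular module. -/
theorem isGendoSymmetric_of_field (K F : Type*) [Field K] [Field F] [Algebra K F]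
    [Module.Finite K F] : IsGendoSymmetric K F := by
  rw [isGendoSymmetric_iff]
  refine ⟨F, inferInstance, inferInstance, F, inferInstance, inferInstance,
    Algebra.lsmul K K F, Algebra.lsmul K K F, isSymmetricAlg_of_field K F, inferInstance,
    ⟨1, fun _ => 1, fun _ => LinearMap.id, fun _ _ _ => rfl, by simp⟩,
    fun a b h => by simpa using LinearMap.congr_fun h 1, fun f => ⟨?_, fun h => ⟨f 1, ?_⟩⟩⟩
  · rintro ⟨a, rfl⟩ b
    exact LinearMap.ext fun x => smul_comm b a x
  · refine LinearMap.ext fun x => ?_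
    simpa [Commute, SemiconjBy, mul_comm] using LinearMap.congr_fun (h (op x)) 1

theorem mainTheorem3 (K : Type u) [Field K] :
    -- the tensor product of two gendo-symmetric `K`-algebras is a gendo-symmetric `K`-algebra
    (∀ (A : Type v) [Ring A] [Algebra K A] (B : Type w) [Ring B] [Algebra K B],
      IsGendoSymmetric K A → IsGendoSymmetric K B → IsGendoSymmetric K (A ⊗[K] B)) ∧
    -- for every field extension `F` of `K`, `A ⊗[K] F` is a gendo-symmetric `F`-algebra, and,
    -- if `F` is finite over `K`, also a gendo-symmetric `K`-algebra
    (∀ (A : Type v) [Ring A] [Algebra K A] (F : Type x) [Field F] [Algebra K F],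
      IsGendoSymmetric K A →
        @IsGendoSymmetric F _ (A ⊗[K] F) _ Algebra.TensorProduct.rightAlgebra ∧
        (Module.Finite K F → IsGendoSymmetric K (A ⊗[K] F))) := by
  refine ⟨fun A _ _ B _ _ hA hB => hA.tensorProduct hB, fun A _ _ F _ _ hA => ⟨?_, fun _ => ?_⟩⟩
  · let : Algebra F (A ⊗[K] F) := Algebra.TensorProduct.rightAlgebra
    -- The tower statement has `F` acting on the left factor, so it yields `F ⊗ A`; swapping the
    -- factors is `F`-linear for the right algebra structure.
    exact ((isGendoSymmetric_of_field F F).tensorProduct hA).of_algEquiv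
      (Algebra.TensorProduct.commRight K F A).symm
  · exact hA.tensorProduct (isGendoSymmetric_of_field K F)
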